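/- Let $\mu \ge 0$ and $f(x) = f_\mu(x) = \mu - \max(\sqrt{\mu}-x,0)^2$. Let $\mathcal{A}:\mathbb{R}^{m\times n}\to\mathbb{R}^p$ be linear and $b\in\mathbb{R}^p$. For $X\in\mathbb{R}^{m\times n}$ with singular values $\sigma_1(X)\ge\dots\ge\sigma_{\min(m,n)}(X)$ put $$\mathcal{R}(X)=\sum_{i=1}^{\min(m,n)} f(\sigma_i(X)),\qquad \mathcal{N}(X)=\mathcal{R}(X)+\|\mathcal{A}X-b\|^2,$$ and for $B\in\mathbb{R}^{m\times 2k}$, $C\in\mathbb{R}^{n\times 2k}$ with columns $B_i$, $C_i$ put $$\tilde{\mathcal{R}}(B,C)=\sum_{i=1}^{2k} f\left(\frac{\|B_i\|^2+\|C_i\|^2}{2}\right),$$ where $\|\cdot\|$ is the Euclidean norm. Let $\bar X = U\Sigma V^T$ be a singular value decomposition with $U\in\mathbb{R}^{m\times 2k}$, $V\in\mathbb{R}^{n\times 2k}$ and $\Sigma$ a $2k\times 2k$ diagonal matrix with non-negative entries; the columns of $U$ and of $V$ that belong to nonzero entries of $\Sigma$ are orthonormal (nothing is required of the other columns). Let $\bar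 B=U\sqrt{\Sigma}$ and $\bar C=V\sqrt{\Sigma}$, so that $\bar X=\bar B\bar C^T$. Assume that $(\bar B,\bar C)$ is a local minimizer over $\mathbb{R}^{m\times 2k}\times\mathbb{R}^{n\times 2k}$ of $$(B,C)\mapsto\tilde{\mathcal{R}}(B,C)+\|\mathcal{A}(BC^T)-b\|^2$$ and that $\mathrm{rank}(\bar X)<k$. Then $\mathcal{R}(\bar X)=\tilde{\mathcal{R}}(\bar B,\bar C)$. Moreover, for every $\tilde X\in\mathbb{R}^{m\times n}$ with $\mathrm{rank}(\tilde X)\le k$, the directional derivative $$\mathcal{N}'_{\Delta X}(\bar X)=\lim_{t\searrow 0}\frac{\mathcal{N}(\bar X+t\,\Delta X)-\mathcal{N}(\bar X)}{t},\qquad \Delta X=\tilde X-\bar X,$$ exists and is non-negative. -/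

import Mathlib

open Filter Topology

noncomputable section

/-- The penalty `f_μ(x) = μ - max(√μ - x, 0)²`. -/
def fmu (μ x : ℝ) : ℝ := μ - max (√μ - x) 0 ^ 2

/-- The `i`-th singular value (counted from `0`, in decreasing order, with multiplicity) of a real
matrix, regarded as an operator between Euclidean spaces. -/
def sing {m n : ℕ} (X : Matrix (Fin m) (Fin n) ℝ) (i : ℕ) : ℝ :=
  (Matrix.toEuclideanLin X).singularValues i

/-- `R(X) = ∑ f(σᵢ(X))`, the sum being over the `min(m, n)` singular values of `X`. -/
def Reg (f : ℝ → ℝ) {m n : ℕ} (X : Matrix (Fin m) (Fin n) ℝ) : ℝ :=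
  ∑ i ∈ Finset.range (min m n), f (sing X i)

/-- The `i`-th column of a matrix as a vector of Euclidean space. -/
def colVec {m q : ℕ} (B : Matrix (Fin m) (Fin q) ℝ) (i : Fin q) : EuclideanSpace ℝ (Fin m) :=
  WithLp.toLp 2 (fun a => B a i)

/-- `R̃(B, C) = ∑ᵢ f((‖Bᵢ‖² + ‖Cᵢ‖²) / 2)`, the sum being over the columns. -/
def RegTilde (f : ℝ → ℝ) {m n q : ℕ} (B : Matrix (Fin m) (Fin q) ℝ)
    (C : Matrix (Fin n) (Fin q) ℝ) : ℝ :=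
  ∑ i : Fin q, f ((‖colVec B i‖ ^ 2 + ‖colVec C i‖ ^ 2) / 2)

/-- The bilinear objective `R̃(B, C) + ‖𝒜(B Cᵀ) - b‖²`. -/
def bilinObj (f : ℝ → ℝ) {m n p q : ℕ}
    (A : Matrix (Fin m) (Fin n) ℝ →ₗ[ℝ] EuclideanSpace ℝ (Fin p)) (b : EuclideanSpace ℝ (Fin p))
    (B : Matrix (Fin m) (Fin q) ℝ) (C : Matrix (Fin n) (Fin q) ℝ) : ℝ :=
  RegTilde f B C + ‖A (B * C.transpose) - b‖ ^ 2

/-- The objective `N(X) = R(X) + ‖𝒜 X - b‖²`. -/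
def matObj (f : ℝ → ℝ) {m n p : ℕ}
    (A : Matrix (Fin m) (Fin n) ℝ →ₗ[ℝ] EuclideanSpace ℝ (Fin p)) (b : EuclideanSpace ℝ (Fin p))
    (X : Matrix (Fin m) (Fin n) ℝ) : ℝ :=
  Reg f X + ‖A X - b‖ ^ 2

/-- `X = U Σ Vᵀ` with `Σ = diag(σ)` of size `q × q` is a singular value decomposition: `σ ≥ 0`, and
the columns of `U`, respectively of `V`, that belong to nonzero singular values are orthonormal.
The columns that belong to the singular value `0` do not contribute to `U Σ Vᵀ`, `U √Σ` or `V √Σ`;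
nothing is asked of them, so that `q` may exceed `m` or `n`. -/
structure IsSVD {m n q : ℕ} (X : Matrix (Fin m) (Fin n) ℝ) (U : Matrix (Fin m) (Fin q) ℝ)
    (σ : Fin q → ℝ) (V : Matrix (Fin n) (Fin q) ℝ) : Prop where
  nonneg : ∀ i, 0 ≤ σ i
  orthonormal_left : Orthonormal ℝ (fun i : {i : Fin q // σ i ≠ 0} => colVec U i)
  orthonormal_right : Orthonormal ℝ (fun i : {i : Fin q // σ i ≠ 0} => colVec V i)
  eq_mul : X = U * Matrix.diagonal σ * V.transpose

/-- The one-sided directional derivative `lim_{t ↘ 0} (N(X + t D) - N(X)) / t` exists and equals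
`L`. -/
def HasDirDeriv {m n : ℕ} (N : Matrix (Fin m) (Fin n) ℝ → ℝ) (X D : Matrix (Fin m) (Fin n) ℝ)
    (L : ℝ) : Prop :=
  Tendsto (fun t : ℝ => (N (X + t • D) - N X) / t) (𝓝[>] 0) (𝓝 L)

end

/-! The penalty splits as `fmu μ x = 2√μ x - huber μ x` with `huber μ` convex, increasing and zero
at `0`. Hence the regularizer is `2√μ` times the nuclear norm minus a convex spectral function
(`convexOn_Reg`), and one-sided directional derivatives exist. Both parts can be evaluated on any
singular value decomposition (`IsSingDecomp.Reg_eq`), which gives equality with the bilinear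
regularizer at the balanced factors.

For the sign, let `ℓ` be the differential of the data term at `X`. First-order conditions in the
nonzero columns determine `ℓ` on `a_i vᵀ` and `u b_iᵀ`. The rank condition leaves a zero column;
second-order optimality there gives `ℓ(u vᵀ) ≥ -√μ (‖u‖² + ‖v‖²)`. With `G = ∑ 2 min(s_i, √μ) a_i
b_iᵀ`, the gradient of the Huber part, these facts make `G - ℓ` a subgradient of `2√μ ‖·‖_*` at `X`
(`subgradient_bound`, `le_mul_Reg_id`). The Huber part is a Moreau envelope, so its linearization
error is at most `t² ‖D‖²` (`IsSingDecomp.Reg_huber_add_le`). Adding up, the objective drops by at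
most `t² ‖D‖²`, which is negligible after division by `t`. -/

open scoped InnerProductSpace

/-! ### Rank-one matrices and the Frobenius inner product -/

/-- The rank-one matrix `u vᵀ`. -/
def outer {m n : ℕ} (u : EuclideanSpace ℝ (Fin m)) (v : EuclideanSpace ℝ (Fin n)) :
    Matrix (Fin m) (Fin n) ℝ :=
  Matrix.vecMulVec u.ofLp v.ofLp

/-- The bilinear pairing `uᵀ X v`. -/
noncomputable def pairing {m n : ℕ} (u : EuclideanSpace ℝ (Fin m)) (X : Matrix (Fin m) (Fin n) ℝ)
    (v : EuclideanSpace ℝ (Fin n)) : ℝ :=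
  ⟪u, Matrix.toEuclideanLin X v⟫_ℝ

/-- A matrix as a vector of the Euclidean space given by the Frobenius norm. -/
noncomputable def frobVec (m n : ℕ) :
    Matrix (Fin m) (Fin n) ℝ →ₗ[ℝ] EuclideanSpace ℝ (Fin m × Fin n) where
  toFun X := WithLp.toLp 2 (fun p => X p.1 p.2)
  map_add' _ _ := rfl
  map_smul' _ _ := rfl

theorem frobVec_apply {m n : ℕ} (X : Matrix (Fin m) (Fin n) ℝ) (p : Fin m × Fin n) :
    frobVec m n X p = X p.1 p.2 := rfl

section Rankone

variable {m n : ℕ}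

theorem outer_add_left (u u' : EuclideanSpace ℝ (Fin m)) (v : EuclideanSpace ℝ (Fin n)) :
    outer (u + u') v = outer u v + outer u' v := by
  ext; simp [outer, Matrix.vecMulVec_apply, add_mul]

theorem outer_add_right (u : EuclideanSpace ℝ (Fin m)) (v v' : EuclideanSpace ℝ (Fin n)) :
    outer u (v + v') = outer u v + outer u v' := by
  ext; simp [outer, Matrix.vecMulVec_apply, mul_add]

theorem outer_smul_left (c : ℝ) (u : EuclideanSpace ℝ (Fin m)) (v : EuclideanSpace ℝ (Fin n)) :
    outer (c • u) v = c • outer u v := by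
  ext; simp [outer, Matrix.vecMulVec_apply, mul_assoc]

theorem outer_smul_right (c : ℝ) (u : EuclideanSpace ℝ (Fin m)) (v : EuclideanSpace ℝ (Fin n)) :
    outer u (c • v) = c • outer u v := by
  ext; simp [outer, Matrix.vecMulVec_apply, mul_left_comm]

theorem outer_zero_left (v : EuclideanSpace ℝ (Fin n)) :
    outer (0 : EuclideanSpace ℝ (Fin m)) v = 0 := by
  simpa using outer_smul_left 0 (0 : EuclideanSpace ℝ (Fin m)) v

theorem outer_zero_right (u : EuclideanSpace ℝ (Fin m)) :
    outer u (0 : EuclideanSpace ℝ (Fin n)) = 0 := by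
  simpa using outer_smul_right 0 u (0 : EuclideanSpace ℝ (Fin n))

theorem outer_sum_left {ι : Type*} (s : Finset ι) (u : ι → EuclideanSpace ℝ (Fin m))
    (v : EuclideanSpace ℝ (Fin n)) : outer (∑ i ∈ s, u i) v = ∑ i ∈ s, outer (u i) v := by
  classical
  induction s using Finset.induction_on with
  | empty => simp [outer_zero_left]
  | insert i s hi ih => simp [Finset.sum_insert hi, outer_add_left, ih]

theorem outer_sum_right {ι : Type*} (s : Finset ι) (u : EuclideanSpace ℝ (Fin m))
    (v : ι → EuclideanSpace ℝ (Fin n)) : outer u (∑ i ∈ s, v i) = ∑ i ∈ s, outer u (v i) := by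
  classical
  induction s using Finset.induction_on with
  | empty => simp [outer_zero_right]
  | insert i s hi ih => simp [Finset.sum_insert hi, outer_add_right, ih]

theorem pairing_add (u : EuclideanSpace ℝ (Fin m)) (X Y : Matrix (Fin m) (Fin n) ℝ)
    (v : EuclideanSpace ℝ (Fin n)) : pairing u (X + Y) v = pairing u X v + pairing u Y v := by
  simp [pairing, inner_add_right]

theorem pairing_smul (u : EuclideanSpace ℝ (Fin m)) (c : ℝ) (X : Matrix (Fin m) (Fin n) ℝ)
    (v : EuclideanSpace ℝ (Fin n)) : pairing u (c • X) v = c * pairing u X v := by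
  simp [pairing, inner_smul_right]

theorem pairing_sum {ι : Type*} (s : Finset ι) (u : EuclideanSpace ℝ (Fin m))
    (X : ι → Matrix (Fin m) (Fin n) ℝ) (v : EuclideanSpace ℝ (Fin n)) :
    pairing u (∑ i ∈ s, X i) v = ∑ i ∈ s, pairing u (X i) v := by
  simp [pairing, inner_sum]

theorem toEuclideanLin_outer (a : EuclideanSpace ℝ (Fin m)) (b v : EuclideanSpace ℝ (Fin n)) :
    Matrix.toEuclideanLin (outer a b) v = ⟪b, v⟫_ℝ • a := by
  ext i
  simp [outer, Matrix.toLpLin_apply, Matrix.mulVec, dotProduct, Matrix.vecMulVec_apply,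
    PiLp.inner_apply, Finset.sum_mul]
  exact Finset.sum_congr rfl fun _ _ => by ring

theorem pairing_outer (u a : EuclideanSpace ℝ (Fin m)) (b v : EuclideanSpace ℝ (Fin n)) :
    pairing u (outer a b) v = ⟪u, a⟫_ℝ * ⟪b, v⟫_ℝ := by
  rw [pairing, toEuclideanLin_outer, inner_smul_right, mul_comm]

theorem inner_frobVec_outer (u : EuclideanSpace ℝ (Fin m)) (v : EuclideanSpace ℝ (Fin n))
    (X : Matrix (Fin m) (Fin n) ℝ) :
    ⟪frobVec m n (outer u v), frobVec m n X⟫_ℝ = pairing u X v := by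
  simp [pairing, frobVec_apply, PiLp.inner_apply, outer, Matrix.vecMulVec_apply, Matrix.toLpLin_apply,
    Matrix.mulVec, dotProduct, Fintype.sum_prod_type, Finset.sum_mul]
  exact Finset.sum_congr rfl fun _ _ => Finset.sum_congr rfl fun _ _ => by ring

/-- Makes Bessel's inequality available for matrices tested against pairs of singular vectors. -/
theorem orthonormal_frobVec_outer {ι : Type*} {a : ι → EuclideanSpace ℝ (Fin m)}
    {b : ι → EuclideanSpace ℝ (Fin n)} (ha : Orthonormal ℝ a) (hb : Orthonormal ℝ b) :
    Orthonormal ℝ fun i => frobVec m n (outer (a i) (b i)) := by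
  classical
  rw [orthonormal_iff_ite] at ha hb ⊢
  intro i j
  rw [inner_frobVec_outer, pairing_outer, ha, hb]
  by_cases h : i = j <;> simp [h, Ne.symm]

end Rankone

/-! ### Singular decompositions and gauge functions -/

/-- `X = ∑ᵢ sᵢ aᵢ bᵢᵀ` with orthonormal families `a`, `b` and nonnegative coefficients `s`. -/
structure IsSingDecomp {m n : ℕ} {ι : Type*} [Fintype ι] (X : Matrix (Fin m) (Fin n) ℝ)
    (a : ι → EuclideanSpace ℝ (Fin m)) (s : ι → ℝ) (b : ι → EuclideanSpace ℝ (Fin n)) : Prop where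
  left : Orthonormal ℝ a
  right : Orthonormal ℝ b
  nonneg : ∀ i, 0 ≤ s i
  eq_sum : X = ∑ i, s i • outer (a i) (b i)

/-- Convex, increasing functions on `[0, ∞)` that vanish at `0`. -/
structure IsGauge (g : ℝ → ℝ) : Prop where
  convex : ConvexOn ℝ (Set.Ici 0) g
  mono : MonotoneOn g (Set.Ici 0)
  map_zero : g 0 = 0

theorem isGauge_id : IsGauge (fun x => x) :=
  ⟨convexOn_id (convex_Ici 0), fun _ _ _ _ h => h, rfl⟩

theorem IsGauge.nonneg {g : ℝ → ℝ} (hg : IsGauge g) {x : ℝ} (hx : 0 ≤ x) : 0 ≤ g x := by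
  simpa [hg.map_zero] using hg.mono (Set.mem_Ici.2 le_rfl) (Set.mem_Ici.2 hx) hx

/-- Jensen's inequality for weights of total mass at most one. -/
theorem IsGauge.map_sum_le {g : ℝ → ℝ} (hg : IsGauge g) {ι : Type*} (t : Finset ι) {w s : ι → ℝ}
    (hw : ∀ i ∈ t, 0 ≤ w i) (hw1 : ∑ i ∈ t, w i ≤ 1) (hs : ∀ i ∈ t, 0 ≤ s i) :
    g (∑ i ∈ t, w i * s i) ≤ ∑ i ∈ t, w i * g (s i) := by
  -- The missing mass `1 - ∑ w` is placed at `0`, where `g` vanishes.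
  have h := hg.convex.map_add_sum_le (t := t) (w := w) (p := s) (v := 1 - ∑ i ∈ t, w i) (q := 0)
    hw (by ring) (by simpa using hs) (by linarith) (by simp)
  simpa [hg.map_zero] using h

section Decomp

variable {m n : ℕ} {ι : Type*} [Fintype ι] {X : Matrix (Fin m) (Fin n) ℝ}
  {a : ι → EuclideanSpace ℝ (Fin m)} {s : ι → ℝ} {b : ι → EuclideanSpace ℝ (Fin n)}

theorem IsSingDecomp.pairing_eq (h : IsSingDecomp X a s b) (u : EuclideanSpace ℝ (Fin m))
    (v : EuclideanSpace ℝ (Fin n)) :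
    pairing u X v = ∑ j, s j * (⟪u, a j⟫_ℝ * ⟪b j, v⟫_ℝ) := by
  rw [h.eq_sum, pairing_sum]
  simp [pairing_smul, pairing_outer]

theorem IsSingDecomp.pairing_self (h : IsSingDecomp X a s b) (i : ι) :
    pairing (a i) X (b i) = s i := by
  classical
  rw [h.pairing_eq, Finset.sum_eq_single i]
  · simp [h.left.1 i, h.right.1 i]
  · intro j _ hj
    simp [orthonormal_iff_ite.1 h.left i j, Ne.symm hj]
  · simp

theorem Orthonormal.sum_sq_inner_le {E : Type*} [NormedAddCommGroup E] [InnerProductSpace ℝ E]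
    {κ : Type*} [Fintype κ] {v : κ → E} (hv : Orthonormal ℝ v) (x : E) :
    ∑ i, ⟪v i, x⟫_ℝ ^ 2 ≤ ‖x‖ ^ 2 := by
  simpa using hv.sum_inner_products_le (s := Finset.univ) x

/-- Among all orthonormal families the singular vectors maximize `∑ g |uᵢᵀ X vᵢ|`. -/
theorem IsSingDecomp.sum_map_pairing_le (h : IsSingDecomp X a s b) {g : ℝ → ℝ} (hg : IsGauge g)
    {κ : Type*} [Fintype κ] {u : κ → EuclideanSpace ℝ (Fin m)} {v : κ → EuclideanSpace ℝ (Fin n)}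
    (hu : Orthonormal ℝ u) (hv : Orthonormal ℝ v) :
    ∑ i, g |pairing (u i) X (v i)| ≤ ∑ j, g (s j) := by
  -- AM-GM on the products of inner products gives these weights; by Bessel they are doubly
  -- substochastic. Row sums feed Jensen, column sums the final bound.
  set w : κ → ι → ℝ := fun i j => (⟪u i, a j⟫_ℝ ^ 2 + ⟪b j, v i⟫_ℝ ^ 2) / 2 with hw
  have hw0 : ∀ i j, 0 ≤ w i j := fun i j => by positivity
  have hrow : ∀ i, ∑ j, w i j ≤ 1 := fun i => by
    have h1 := h.left.sum_sq_inner_le (u i)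
    have h2 := h.right.sum_sq_inner_le (v i)
    simp only [hu.1 i, hv.1 i, real_inner_comm (u i)] at h1 h2
    simp only [hw, ← Finset.sum_div, Finset.sum_add_distrib]
    linarith
  have hcol : ∀ j, ∑ i, w i j ≤ 1 := fun j => by
    have h1 := hu.sum_sq_inner_le (a j)
    have h2 := hv.sum_sq_inner_le (b j)
    simp only [h.left.1 j, h.right.1 j, real_inner_comm (b j)] at h1 h2
    simp only [hw, ← Finset.sum_div, Finset.sum_add_distrib]
    linarith
  have hp : ∀ i, |pairing (u i) X (v i)| ≤ ∑ j, w i j * s j := fun i => by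
    rw [h.pairing_eq]
    refine (Finset.abs_sum_le_sum_abs _ _).trans (Finset.sum_le_sum fun j _ => ?_)
    rw [abs_mul, abs_of_nonneg (h.nonneg j), mul_comm]
    refine mul_le_mul_of_nonneg_right ?_ (h.nonneg j)
    simp only [hw]
    rw [abs_le]
    constructor <;> nlinarith [sq_nonneg (⟪u i, a j⟫_ℝ - ⟪b j, v i⟫_ℝ),
      sq_nonneg (⟪u i, a j⟫_ℝ + ⟪b j, v i⟫_ℝ)]
  calc ∑ i, g |pairing (u i) X (v i)| ≤ ∑ i, ∑ j, w i j * g (s j) :=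
        Finset.sum_le_sum fun i _ =>
          (hg.mono (Set.mem_Ici.2 (abs_nonneg _))
            (Set.mem_Ici.2 (Finset.sum_nonneg fun j _ => mul_nonneg (hw0 i j) (h.nonneg j)))
            (hp i)).trans
          (hg.map_sum_le _ (fun j _ => hw0 i j) (hrow i) fun j _ => h.nonneg j)
    _ = ∑ j, (∑ i, w i j) * g (s j) := by
        rw [Finset.sum_comm]; simp [Finset.sum_mul]
    _ ≤ ∑ j, g (s j) := Finset.sum_le_sum fun j _ =>
        mul_le_of_le_one_left (hg.nonneg (h.nonneg j)) (hcol j)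

/-- The inequality of `IsSingDecomp.sum_map_pairing_le` for another singular value
decomposition. -/
theorem IsSingDecomp.sum_map_le (h : IsSingDecomp X a s b) {g : ℝ → ℝ} (hg : IsGauge g)
    {κ : Type*} [Fintype κ] {a' : κ → EuclideanSpace ℝ (Fin m)} {s' : κ → ℝ}
    {b' : κ → EuclideanSpace ℝ (Fin n)} (h' : IsSingDecomp X a' s' b') :
    ∑ i, g (s' i) ≤ ∑ j, g (s j) := by
  simpa [h'.pairing_self, abs_of_nonneg (h'.nonneg _)] using
    h.sum_map_pairing_le hg h'.left h'.right

end Decomp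

theorem sum_eq_sum_subtype_ne_zero {ι M : Type*} [Fintype ι] [AddCommMonoid M]
    {s : ι → ℝ} {h : ι → M} (h0 : ∀ i, s i = 0 → h i = 0) : ∑ i, h i = ∑ i : {i // s i ≠ 0}, h i.1 := by
  classical
  rw [← Finset.sum_filter_of_ne (p := fun i => s i ≠ 0) fun i _ hi hs => hi (h0 i hs)]
  exact Finset.sum_subtype _ (by simp) _

/-! ### Spectral functions of the singular values -/

section Sing

variable {m n : ℕ}

theorem sing_nonneg (X : Matrix (Fin m) (Fin n) ℝ) (i : ℕ) : 0 ≤ sing X i :=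
  LinearMap.singularValues_nonneg _ i

theorem sing_eq_zero_of_le (X : Matrix (Fin m) (Fin n) ℝ) {i : ℕ} (hi : min m n ≤ i) :
    sing X i = 0 := by
  have h1 : Module.finrank ℝ (Matrix.toEuclideanLin X).range ≤ m := by
    simpa using Submodule.finrank_le (Matrix.toEuclideanLin X).range
  have h2 : Module.finrank ℝ (Matrix.toEuclideanLin X).range ≤ n := by
    simpa using LinearMap.finrank_range_le (Matrix.toEuclideanLin X)
  exact (LinearMap.singularValues_eq_zero_iff_le_finrank_range _).2 ((le_min h1 h2).trans hi)

theorem Reg_eq_sum_ne_zero {g : ℝ → ℝ} (hg : g 0 = 0) (X : Matrix (Fin m) (Fin n) ℝ) :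
    Reg g X = ∑ i : {i : Fin n // sing X i ≠ 0}, g (sing X i.1) := by
  have h1 : Reg g X = ∑ i ∈ Finset.range n, g (sing X i) := by
    refine Finset.sum_subset (Finset.range_subset_range.2 (min_le_right _ _)) fun i _ hi => ?_
    rw [sing_eq_zero_of_le X (not_lt.1 fun h => hi (Finset.mem_range.2 h)), hg]
  rw [h1, Finset.sum_range]
  exact sum_eq_sum_subtype_ne_zero (s := fun i : Fin n => sing X i) fun i hi => by rw [hi, hg]

/-- The right vectors are eigenvectors `e i` of `TᵀT` with nonzero eigenvalue; the left ones are the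
normalized images `T (e i)`. -/
theorem exists_isSingDecomp (X : Matrix (Fin m) (Fin n) ℝ) :
    ∃ (a : {i : Fin n // sing X i ≠ 0} → EuclideanSpace ℝ (Fin m))
      (b : {i : Fin n // sing X i ≠ 0} → EuclideanSpace ℝ (Fin n)),
      IsSingDecomp X a (fun i => sing X i.1) b := by
  classical
  set T := Matrix.toEuclideanLin X with hT
  have hn : Module.finrank ℝ (EuclideanSpace ℝ (Fin n)) = n := by simp
  set e := T.isSymmetric_adjoint_comp_self.eigenvectorBasis hn with he
  have hinner : ∀ i j : Fin n, ⟪T (e i), T (e j)⟫_ℝ = if i = j then sing X i ^ 2 else 0 := by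
    intro i j
    rw [← LinearMap.adjoint_inner_right, ← LinearMap.comp_apply, he,
      T.isSymmetric_adjoint_comp_self.apply_eigenvectorBasis hn j, inner_smul_right,
      orthonormal_iff_ite.1 (T.isSymmetric_adjoint_comp_self.eigenvectorBasis hn).orthonormal,
      ← T.sq_singularValues_fin hn]
    by_cases h : i = j <;> simp [h, sing, hT]
  refine ⟨fun i => (sing X i.1)⁻¹ • T (e i.1), fun i => e i.1, ?_, ?_, fun i => sing_nonneg X _, ?_⟩
  · rw [orthonormal_iff_ite]
    rintro ⟨i, hi⟩ ⟨j, hj⟩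
    rw [inner_smul_left, inner_smul_right, hinner]
    by_cases h : i = j
    · subst h
      simp
      field_simp
    · simp [h]
  · exact e.orthonormal.comp _ Subtype.val_injective
  · apply Matrix.toEuclideanLin.injective
    apply e.toBasis.ext
    intro j
    rw [map_sum, LinearMap.sum_apply]
    simp only [map_smul, LinearMap.smul_apply, toEuclideanLin_outer, OrthonormalBasis.coe_toBasis,
      orthonormal_iff_ite.1 e.orthonormal]
    by_cases hj : sing X j = 0
    · have h0 : T (e j) = 0 := by
        rw [← inner_self_eq_zero (𝕜 := ℝ), hinner]; simp [hj]
      rw [← hT, h0, Finset.sum_eq_zero]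
      rintro ⟨i, hi⟩ _
      have : i ≠ j := by rintro rfl; exact hi hj
      simp [this]
    · rw [Finset.sum_eq_single ⟨j, hj⟩]
      · simp [smul_smul, hj, ← hT]
      · rintro ⟨i, hi⟩ _ h
        have : i ≠ j := by rintro rfl; exact h rfl
        simp [this]
      · simp

variable {ι : Type*} [Fintype ι] {X : Matrix (Fin m) (Fin n) ℝ}
  {a : ι → EuclideanSpace ℝ (Fin m)} {s : ι → ℝ} {b : ι → EuclideanSpace ℝ (Fin n)}

/-- `Reg g X` may be computed from any singular value decomposition. -/
theorem IsSingDecomp.Reg_eq (h : IsSingDecomp X a s b) {g : ℝ → ℝ} (hg : IsGauge g) :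
    Reg g X = ∑ i, g (s i) := by
  obtain ⟨a', b', h'⟩ := exists_isSingDecomp X
  rw [Reg_eq_sum_ne_zero hg.map_zero]
  exact le_antisymm (h.sum_map_le hg h') (h'.sum_map_le hg h)

theorem sum_map_pairing_le_Reg (X : Matrix (Fin m) (Fin n) ℝ) {g : ℝ → ℝ} (hg : IsGauge g)
    {u : ι → EuclideanSpace ℝ (Fin m)} {v : ι → EuclideanSpace ℝ (Fin n)}
    (hu : Orthonormal ℝ u) (hv : Orthonormal ℝ v) :
    ∑ i, g |pairing (u i) X (v i)| ≤ Reg g X := by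
  obtain ⟨a', b', h'⟩ := exists_isSingDecomp X
  rw [h'.Reg_eq hg]
  exact h'.sum_map_pairing_le hg hu hv

/-- Davis' convexity theorem for rectangular matrices. -/
theorem convexOn_Reg {g : ℝ → ℝ} (hg : IsGauge g) :
    ConvexOn ℝ Set.univ (Reg g : Matrix (Fin m) (Fin n) ℝ → ℝ) := by
  refine ⟨convex_univ, fun X _ Y _ α β hα hβ hαβ => ?_⟩
  -- The singular vectors of the combination are test families for `X` and `Y`, where the
  -- variational bound applies.
  obtain ⟨a, b, h⟩ := exists_isSingDecomp (α • X + β • Y)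
  rw [h.Reg_eq hg]
  calc ∑ i : {i : Fin n // sing (α • X + β • Y) i ≠ 0}, g (sing (α • X + β • Y) i.1)
      ≤ ∑ i, (α * g |pairing (a i) X (b i)| + β * g |pairing (a i) Y (b i)|) := by
        refine Finset.sum_le_sum fun i _ => ?_
        have hle : sing (α • X + β • Y) i.1 ≤
            α * |pairing (a i) X (b i)| + β * |pairing (a i) Y (b i)| := by
          rw [← h.pairing_self i, pairing_add, pairing_smul, pairing_smul]
          gcongr <;> exact le_abs_self _
        have hnn := (sing_nonneg (α • X + β • Y) i.1)
        exact (hg.mono (Set.mem_Ici.2 hnn) (Set.mem_Ici.2 (hnn.trans hle)) hle).trans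
          (hg.convex.2 (Set.mem_Ici.2 (abs_nonneg _)) (Set.mem_Ici.2 (abs_nonneg _)) hα hβ hαβ)
    _ = α * ∑ i, g |pairing (a i) X (b i)| + β * ∑ i, g |pairing (a i) Y (b i)| := by
        rw [Finset.sum_add_distrib, Finset.mul_sum, Finset.mul_sum]
    _ ≤ α • Reg g X + β • Reg g Y := by
        rw [smul_eq_mul, smul_eq_mul]
        gcongr
        · exact sum_map_pairing_le_Reg X hg h.left h.right
        · exact sum_map_pairing_le_Reg Y hg h.left h.right

/-- Duality between the nuclear norm and the operator norm. -/
theorem le_mul_Reg_id (ψ : Matrix (Fin m) (Fin n) ℝ →ₗ[ℝ] ℝ) {c : ℝ}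
    (hψ : ∀ u v, ψ (outer u v) ≤ c * (‖u‖ ^ 2 + ‖v‖ ^ 2)) (X : Matrix (Fin m) (Fin n) ℝ) :
    ψ X ≤ 2 * c * Reg (fun x => x) X := by
  obtain ⟨a, b, h⟩ := exists_isSingDecomp X
  rw [h.Reg_eq isGauge_id, Finset.mul_sum]
  calc ψ X = ∑ i, sing X i.1 * ψ (outer (a i) (b i)) := by
        conv_lhs => rw [h.eq_sum]
        simp
    _ ≤ ∑ i, 2 * c * sing X i.1 := Finset.sum_le_sum fun i _ => by
        have h1 := hψ (a i) (b i)
        rw [h.left.1 i, h.right.1 i] at h1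
        nlinarith [h.nonneg i]

/-- The gauge `g` is bounded by the Moreau envelope `inf_Y ‖X - Y‖² + c ‖Y‖_*`, if this holds for
numbers. -/
theorem Reg_le_of_decomp {g : ℝ → ℝ} (hg : IsGauge g) {c : ℝ} (hc : 0 ≤ c)
    (hle : ∀ x y : ℝ, 0 ≤ x → g x ≤ (x - y) ^ 2 + c * |y|)
    (h : IsSingDecomp X a s b) (Z : Matrix (Fin m) (Fin n) ℝ) :
    Reg g Z ≤ ‖frobVec m n (Z - X)‖ ^ 2 + c * ∑ i, s i := by
  obtain ⟨u, v, hZ⟩ := exists_isSingDecomp Z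
  rw [hZ.Reg_eq hg]
  have h1 := h.sum_map_pairing_le isGauge_id hZ.left hZ.right
  -- Bessel controls the quadratic part by the Frobenius norm, while `h1` controls the nuclear part;
  -- the scalar bound is then summed.
  have h2 := (orthonormal_frobVec_outer hZ.left hZ.right).sum_sq_inner_le (frobVec m n (Z - X))
  have h3 : ∀ i, ⟪frobVec m n (outer (u i) (v i)), frobVec m n (Z - X)⟫_ℝ =
      sing Z i.1 - pairing (u i) X (v i) := fun i => by
    rw [inner_frobVec_outer, sub_eq_add_neg, pairing_add, ← neg_one_smul ℝ X, pairing_smul,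
      hZ.pairing_self]
    ring
  simp only [h3] at h2
  calc _ ≤ ∑ i : {i : Fin n // sing Z i ≠ 0},
        ((sing Z i.1 - pairing (u i) X (v i)) ^ 2 + c * |pairing (u i) X (v i)|) :=
        Finset.sum_le_sum fun i _ => hle _ _ (hZ.nonneg i)
    _ ≤ _ := by
        rw [Finset.sum_add_distrib, ← Finset.mul_sum]
        exact add_le_add h2 (mul_le_mul_of_nonneg_left h1 hc)

end Sing

/-! ### The scalar penalty and its Huber function -/

/-- The slope of `fmu μ` at `x`. -/
noncomputable def fmuSlope (μ x : ℝ) : ℝ := 2 * max (√μ - x) 0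

/-- The convex function `2√μ x - fmu μ x`, which is a Huber function. -/
noncomputable def huber (μ x : ℝ) : ℝ := 2 * √μ * x - fmu μ x

/-- Concavity: the graph lies below each tangent line. -/
theorem fmu_sub_le (μ x y : ℝ) : fmu μ y - fmu μ x ≤ fmuSlope μ x * (y - x) := by
  unfold fmu fmuSlope
  rcases max_cases (√μ - x) 0 with ⟨h1, h1'⟩ | ⟨h1, h1'⟩ <;>
  rcases max_cases (√μ - y) 0 with ⟨h2, h2'⟩ | ⟨h2, h2'⟩ <;> rw [h1, h2] <;>
  nlinarith [sq_nonneg (x - y), sq_nonneg (√μ - x), sq_nonneg (√μ - y)]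

theorem fmu_zero {μ : ℝ} (hμ : 0 ≤ μ) : fmu μ 0 = 0 := by
  simp [fmu, Real.sq_sqrt hμ]

theorem isGauge_huber {μ : ℝ} (hμ : 0 ≤ μ) : IsGauge (huber μ) := by
  refine ⟨⟨convex_Ici 0, fun x _ y _ α β hα hβ hαβ => ?_⟩, fun x hx y _ hxy => ?_, ?_⟩
  · have h1 := fmu_sub_le μ (α * x + β * y) x
    have h2 := fmu_sub_le μ (α * x + β * y) y
    simp only [huber, smul_eq_mul]
    generalize fmuSlope μ (α * x + β * y) = d at *
    generalize fmu μ (α * x + β * y) = f at *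
    have h3 := mul_le_mul_of_nonneg_left h1 hα
    have h4 := mul_le_mul_of_nonneg_left h2 hβ
    obtain rfl : β = 1 - α := by linarith
    nlinarith
  · have h1 := fmu_sub_le μ x y
    have h2 : fmuSlope μ x ≤ 2 * √μ := by
      have : max (√μ - x) 0 ≤ √μ := max_le (by linarith [Set.mem_Ici.1 hx]) (Real.sqrt_nonneg μ)
      unfold fmuSlope; linarith
    have h3 := mul_le_mul_of_nonneg_right h2 (sub_nonneg.2 hxy)
    simp only [huber]
    linarith
  · simp [huber, fmu_zero hμ]

/-- On `[0, ∞)` the Huber function is the Moreau envelope of `2√μ |y|`; the minimizing `y` is the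
soft threshold `x - min x √μ`. -/
theorem huber_le {μ : ℝ} (hμ : 0 ≤ μ) (x y : ℝ) (hx : 0 ≤ x) :
    huber μ x ≤ (x - y) ^ 2 + 2 * √μ * |y| := by
  have hs := Real.sq_sqrt hμ
  have h0 := Real.sqrt_nonneg μ
  have hy := abs_nonneg y
  have hy' := neg_abs_le y
  have hy'' := le_abs_self y
  unfold huber fmu
  generalize √μ = r at *
  rcases max_cases (r - x) 0 with ⟨h1, h1'⟩ | ⟨h1, h1'⟩ <;> rw [h1]
  · nlinarith [sq_nonneg y, sq_abs y, mul_nonneg hy (sub_nonneg.2 h1'), mul_nonneg hx (sub_nonneg.2 hy'')]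
  · nlinarith [sq_nonneg (x - y - r), mul_nonneg h0 (sub_nonneg.2 hy'')]

/-- Equality in `huber_le` at the proximal point. -/
theorem huber_eq {μ : ℝ} (hμ : 0 ≤ μ) (x : ℝ) :
    huber μ x = min x √μ ^ 2 + 2 * √μ * (x - min x √μ) := by
  have hs := Real.sq_sqrt hμ
  unfold huber fmu
  rcases le_total x √μ with h | h
  · rw [min_eq_left h, max_eq_left (by linarith)]; nlinarith
  · rw [min_eq_right h, max_eq_right (by linarith)]; nlinarith

theorem fmuSlope_add_min (μ x : ℝ) : fmuSlope μ x + 2 * min x √μ = 2 * √μ := by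
  unfold fmuSlope
  rcases le_total x √μ with h | h
  · rw [min_eq_left h, max_eq_left (by linarith)]; ring
  · rw [min_eq_right h, max_eq_right (by linarith)]; ring

theorem Reg_fmu_eq {m n : ℕ} (μ : ℝ) (X : Matrix (Fin m) (Fin n) ℝ) :
    Reg (fmu μ) X = 2 * √μ * Reg (fun x => x) X - Reg (huber μ) X := by
  simp [Reg, huber, Finset.mul_sum]

/-! ### One-sided directional derivatives -/

section Line

variable {m n : ℕ}

/-- A convex function has all one-sided directional derivatives. -/
theorem exists_hasDirDeriv_of_convexOn {N : Matrix (Fin m) (Fin n) ℝ → ℝ}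
    (hN : ConvexOn ℝ Set.univ N) (X D : Matrix (Fin m) (Fin n) ℝ) : ∃ L, HasDirDeriv N X D L := by
  have hc : ConvexOn ℝ Set.univ fun t : ℝ => N (X + t • D) := by
    refine ⟨convex_univ, fun s _ t _ α β hα hβ hαβ => ?_⟩
    have h := hN.2 (Set.mem_univ (X + s • D)) (Set.mem_univ (X + t • D)) hα hβ hαβ
    have he : X + (α • s + β • t) • D = α • (X + s • D) + β • (X + t • D) := by
      obtain rfl : α = 1 - β := by linarith
      simp only [smul_eq_mul]
      module
    simpa only [he] using h
  have hd := hc.hasDerivWithinAt_rightDeriv_of_mem_interior (x := 0) (by simp)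
  refine ⟨_, ((hasDerivWithinAt_iff_tendsto_slope' (by simp)).1 hd).congr fun t => ?_⟩
  simp [slope_def_field]

theorem HasDirDeriv.add {N N' : Matrix (Fin m) (Fin n) ℝ → ℝ} {X D : Matrix (Fin m) (Fin n) ℝ}
    {L L' : ℝ} (h : HasDirDeriv N X D L) (h' : HasDirDeriv N' X D L') :
    HasDirDeriv (fun Z => N Z + N' Z) X D (L + L') :=
  (Tendsto.add h h').congr fun t => by ring

theorem HasDirDeriv.const_mul {N : Matrix (Fin m) (Fin n) ℝ → ℝ} {X D : Matrix (Fin m) (Fin n) ℝ}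
    {L : ℝ} (h : HasDirDeriv N X D L) (c : ℝ) : HasDirDeriv (fun Z => c * N Z) X D (c * L) :=
  (Tendsto.const_mul c h).congr fun t => by ring

/-- The differential of `Z ↦ ‖A Z - b‖²` at `X`. -/
noncomputable def fitDeriv {p : ℕ}
    (A : Matrix (Fin m) (Fin n) ℝ →ₗ[ℝ] EuclideanSpace ℝ (Fin p)) (b : EuclideanSpace ℝ (Fin p))
    (X : Matrix (Fin m) (Fin n) ℝ) : Matrix (Fin m) (Fin n) ℝ →ₗ[ℝ] ℝ :=
  (2 : ℝ) • (innerₗ (EuclideanSpace ℝ (Fin p)) (A X - b)).comp A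

variable {p : ℕ} (A : Matrix (Fin m) (Fin n) ℝ →ₗ[ℝ] EuclideanSpace ℝ (Fin p))
  (b : EuclideanSpace ℝ (Fin p)) (X : Matrix (Fin m) (Fin n) ℝ)

theorem norm_fit_add_sq (D : Matrix (Fin m) (Fin n) ℝ) :
    ‖A (X + D) - b‖ ^ 2 = ‖A X - b‖ ^ 2 + fitDeriv A b X D + ‖A D‖ ^ 2 := by
  rw [map_add, add_sub_right_comm, norm_add_sq_real]
  rfl

theorem hasDirDeriv_fit (D : Matrix (Fin m) (Fin n) ℝ) :
    HasDirDeriv (fun Z => ‖A Z - b‖ ^ 2) X D (fitDeriv A b X D) := by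
  have h : Tendsto (fun t : ℝ => fitDeriv A b X D + t * ‖A D‖ ^ 2) (𝓝[>] 0)
      (𝓝 (fitDeriv A b X D)) := by
    have : Continuous fun t : ℝ => fitDeriv A b X D + t * ‖A D‖ ^ 2 := by fun_prop
    simpa using (this.tendsto 0).mono_left nhdsWithin_le_nhds
  refine h.congr' ?_
  filter_upwards [self_mem_nhdsWithin] with t ht
  have ht : t ≠ 0 := (Set.mem_Ioi.1 ht).ne'
  rw [norm_fit_add_sq, map_smul, map_smul, norm_smul, smul_eq_mul, mul_pow, Real.norm_eq_abs,
    sq_abs]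
  field_simp
  ring

theorem exists_hasDirDeriv_matObj {μ : ℝ} (hμ : 0 ≤ μ) (D : Matrix (Fin m) (Fin n) ℝ) :
    ∃ L, HasDirDeriv (matObj (fmu μ) A b) X D L := by
  obtain ⟨L₁, h₁⟩ := exists_hasDirDeriv_of_convexOn (convexOn_Reg isGauge_id) X D
  obtain ⟨L₂, h₂⟩ := exists_hasDirDeriv_of_convexOn (convexOn_Reg (isGauge_huber hμ)) X D
  refine ⟨_, (((h₁.const_mul (2 * √μ)).add (h₂.const_mul (-1))).add
    (hasDirDeriv_fit A b X D)).congr fun t => ?_⟩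
  simp only [matObj, Reg_fmu_eq]
  ring

variable {A b X}

theorem HasDirDeriv.nonneg {N : Matrix (Fin m) (Fin n) ℝ → ℝ} {D : Matrix (Fin m) (Fin n) ℝ}
    {L K : ℝ} (h : HasDirDeriv N X D L) (hK : ∀ t : ℝ, 0 < t → -(t ^ 2 * K) ≤ N (X + t • D) - N X) :
    0 ≤ L := by
  have h0 : Tendsto (fun t : ℝ => -(t * K)) (𝓝[>] 0) (𝓝 0) := by
    have : Continuous fun t : ℝ => -(t * K) := by fun_prop
    simpa using (this.tendsto 0).mono_left nhdsWithin_le_nhds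
  refine le_of_tendsto_of_tendsto h0 h ?_
  filter_upwards [self_mem_nhdsWithin] with t ht
  have ht : 0 < t := ht
  rw [le_div_iff₀ ht]
  linarith [hK t ht]

end Line

/-! ### Optimality conditions from single-column perturbations -/

section Perturb

variable {m n p q : ℕ} {A : Matrix (Fin m) (Fin n) ℝ →ₗ[ℝ] EuclideanSpace ℝ (Fin p)}
  {b : EuclideanSpace ℝ (Fin p)} {B : Matrix (Fin m) (Fin q) ℝ} {C : Matrix (Fin n) (Fin q) ℝ}

theorem colVec_add_outer_single (B : Matrix (Fin m) (Fin q) ℝ) (i j : Fin q) (t : ℝ)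
    (u : EuclideanSpace ℝ (Fin m)) :
    colVec (B + t • outer u (EuclideanSpace.single i 1)) j =
      colVec B j + if j = i then t • u else 0 := by
  ext a
  by_cases h : j = i <;> simp [colVec, outer, Matrix.vecMulVec_apply, h]

theorem mul_transpose_add_outer_single (B : Matrix (Fin m) (Fin q) ℝ)
    (C : Matrix (Fin n) (Fin q) ℝ) (i : Fin q) (t : ℝ) (u : EuclideanSpace ℝ (Fin m))
    (v : EuclideanSpace ℝ (Fin n)) :
    (B + t • outer u (EuclideanSpace.single i 1)) *
        (C + t • outer v (EuclideanSpace.single i 1)).transpose =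
      B * C.transpose + (t • (outer u (colVec C i) + outer (colVec B i) v) +
        t ^ 2 • outer u v) := by
  ext a c
  have h : ∀ x y : Fin q → ℝ, (∑ j, (x j + t * (u a * (Pi.single i 1 : Fin q → ℝ) j)) *
      (y j + t * ((Pi.single i 1 : Fin q → ℝ) j * v c))) =
      ∑ j, x j * y j + (t * (u a * y i + x i * v c) + t ^ 2 * (u a * v c)) := by
    intro x y
    rw [← sub_eq_iff_eq_add', ← Finset.sum_sub_distrib, Finset.sum_eq_single i]
    · simp; ring
    · intro j _ hj
      simp [hj]
    · simp
  simpa [colVec, outer, Matrix.vecMulVec_apply, Matrix.mul_apply, mul_add] using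
    h (B a) (C c)

/-- Concavity of the penalty suffices: a local minimizer only needs an upper bound on the perturbed
objective. -/
theorem RegTilde_perturb_le (μ : ℝ) (B : Matrix (Fin m) (Fin q) ℝ)
    (C : Matrix (Fin n) (Fin q) ℝ) (i : Fin q) (t : ℝ) (u : EuclideanSpace ℝ (Fin m))
    (v : EuclideanSpace ℝ (Fin n)) :
    RegTilde (fmu μ) (B + t • outer u (EuclideanSpace.single i 1))
        (C + t • outer v (EuclideanSpace.single i 1)) - RegTilde (fmu μ) B C ≤
      fmuSlope μ ((‖colVec B i‖ ^ 2 + ‖colVec C i‖ ^ 2) / 2) *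
        (t * (⟪colVec B i, u⟫_ℝ + ⟪colVec C i, v⟫_ℝ) + t ^ 2 * ((‖u‖ ^ 2 + ‖v‖ ^ 2) / 2)) := by
  unfold RegTilde
  rw [← Finset.sum_sub_distrib]
  refine (Finset.sum_le_sum fun j _ => fmu_sub_le μ _ _).trans_eq ?_
  simp only [colVec_add_outer_single]
  rw [Finset.sum_eq_single i]
  · simp only [if_true, norm_add_sq_real, inner_smul_right, norm_smul, mul_pow, Real.norm_eq_abs,
      sq_abs]
    ring
  · intro j _ hj
    simp [hj]
  · simp

/-- The expansion of the objective along a perturbation of a single column. -/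
theorem eventually_column_expansion {μ : ℝ}
    (hmin : IsLocalMin (fun P : Matrix (Fin m) (Fin q) ℝ × Matrix (Fin n) (Fin q) ℝ =>
      bilinObj (fmu μ) A b P.1 P.2) (B, C)) (i : Fin q) (u : EuclideanSpace ℝ (Fin m))
    (v : EuclideanSpace ℝ (Fin n)) {d : ℝ}
    (hd : fmuSlope μ ((‖colVec B i‖ ^ 2 + ‖colVec C i‖ ^ 2) / 2) = d) :
    ∀ᶠ t : ℝ in 𝓝 0, 0 ≤
      t * (d * (⟪colVec B i, u⟫_ℝ + ⟪colVec C i, v⟫_ℝ) + fitDeriv A b (B * C.transpose)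
        (outer u (colVec C i) + outer (colVec B i) v)) +
      t ^ 2 * (d * ((‖u‖ ^ 2 + ‖v‖ ^ 2) / 2) + fitDeriv A b (B * C.transpose) (outer u v) +
        ‖A (outer u (colVec C i) + outer (colVec B i) v) + t • A (outer u v)‖ ^ 2) := by
  have hc : Tendsto (fun t : ℝ => (B + t • outer u (EuclideanSpace.single i 1),
      C + t • outer v (EuclideanSpace.single i 1))) (𝓝 0) (𝓝 (B, C)) := by
    have : Continuous fun t : ℝ => (B + t • outer u (EuclideanSpace.single i (1 : ℝ)),
      C + t • outer v (EuclideanSpace.single i (1 : ℝ))) := by fun_prop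
    simpa using this.tendsto 0
  filter_upwards [hc.eventually hmin] with t ht
  have h1 := RegTilde_perturb_le μ B C i t u v
  rw [hd] at h1
  simp only [bilinObj, mul_transpose_add_outer_single] at ht
  rw [norm_fit_add_sq] at ht
  generalize outer u (colVec C i) + outer (colVec B i) v = Z at *
  have h2 : A (t • Z + t ^ 2 • outer u v) = t • (A Z + t • A (outer u v)) := by
    rw [map_add, map_smul, map_smul]
    module
  rw [h2, map_add, map_smul, map_smul, smul_eq_mul, smul_eq_mul, norm_smul, mul_pow, Real.norm_eq_abs, sq_abs] at ht
  linarith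

/-- Stationarity of a local minimizer with respect to a single column. -/
theorem column_stationary {μ : ℝ}
    (hmin : IsLocalMin (fun P : Matrix (Fin m) (Fin q) ℝ × Matrix (Fin n) (Fin q) ℝ =>
      bilinObj (fmu μ) A b P.1 P.2) (B, C)) (i : Fin q) (u : EuclideanSpace ℝ (Fin m))
    (v : EuclideanSpace ℝ (Fin n)) {d : ℝ}
    (hd : fmuSlope μ ((‖colVec B i‖ ^ 2 + ‖colVec C i‖ ^ 2) / 2) = d) :
    d * (⟪colVec B i, u⟫_ℝ + ⟪colVec C i, v⟫_ℝ) + fitDeriv A b (B * C.transpose)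
        (outer u (colVec C i) + outer (colVec B i) v) = 0 := by
  have h := eventually_column_expansion hmin i u v hd
  generalize d * (⟪colVec B i, u⟫_ℝ + ⟪colVec C i, v⟫_ℝ) + fitDeriv A b (B * C.transpose)
        (outer u (colVec C i) + outer (colVec B i) v) = P at *
  generalize A (outer u (colVec C i) + outer (colVec B i) v) = z₁ at *
  generalize A (outer u v) = z₂ at *
  generalize d * ((‖u‖ ^ 2 + ‖v‖ ^ 2) / 2) + fitDeriv A b (B * C.transpose) (outer u v) = Q at *
  have hc : Tendsto (fun t : ℝ => P + t * (Q + ‖z₁ + t • z₂‖ ^ 2)) (𝓝 0) (𝓝 P) := by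
    have : Continuous fun t : ℝ => P + t * (Q + ‖z₁ + t • z₂‖ ^ 2) := by fun_prop
    simpa using this.tendsto 0
  -- Dividing by `t < 0` and by `t > 0` gives the two inequalities in the limit.
  apply le_antisymm
  · refine le_of_tendsto (hc.mono_left (nhdsWithin_le_nhds (s := Set.Iio 0))) ?_
    filter_upwards [nhdsWithin_le_nhds h, self_mem_nhdsWithin] with t ht ht0
    have ht0 : t < 0 := ht0
    by_contra! hlt
    nlinarith [mul_pos_of_neg_of_neg ht0 (neg_lt_zero.2 hlt)]
  · refine ge_of_tendsto (hc.mono_left (nhdsWithin_le_nhds (s := Set.Ioi 0))) ?_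
    filter_upwards [nhdsWithin_le_nhds h, self_mem_nhdsWithin] with t ht ht0
    have ht0 : 0 < t := ht0
    by_contra! hlt
    nlinarith [mul_pos ht0 (neg_pos.2 hlt)]

/-- The second order condition at a vanishing column. -/
theorem zero_column_second_order {μ : ℝ}
    (hmin : IsLocalMin (fun P : Matrix (Fin m) (Fin q) ℝ × Matrix (Fin n) (Fin q) ℝ =>
      bilinObj (fmu μ) A b P.1 P.2) (B, C)) {i : Fin q} (hB : colVec B i = 0)
    (hC : colVec C i = 0) (u : EuclideanSpace ℝ (Fin m)) (v : EuclideanSpace ℝ (Fin n)) :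
    0 ≤ √μ * (‖u‖ ^ 2 + ‖v‖ ^ 2) + fitDeriv A b (B * C.transpose) (outer u v) := by
  have h := eventually_column_expansion hmin i u v rfl
  simp only [hB, hC, outer_zero_left, outer_zero_right, inner_zero_left, add_zero, map_zero,
    mul_zero, zero_add, norm_zero] at h
  have hd : fmuSlope μ ((0 ^ 2 + 0 ^ 2) / 2) = 2 * √μ := by
    simp [fmuSlope]
  rw [hd] at h
  have hQ : 2 * √μ * ((‖u‖ ^ 2 + ‖v‖ ^ 2) / 2) = √μ * (‖u‖ ^ 2 + ‖v‖ ^ 2) := by ring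
  rw [hQ] at h
  generalize √μ * (‖u‖ ^ 2 + ‖v‖ ^ 2) + fitDeriv A b (B * C.transpose) (outer u v) = Q at *
  -- At a zero column the linear term vanishes and `B Cᵀ` moves only by `t² u vᵀ`, so after division
  -- by `t²` the quadratic data term still tends to `0`.
  have hc : Tendsto (fun t : ℝ => Q + ‖t • A (outer u v)‖ ^ 2) (𝓝[>] 0) (𝓝 Q) := by
    have : Continuous fun t : ℝ => Q + ‖t • A (outer u v)‖ ^ 2 := by fun_prop
    simpa using (this.tendsto 0).mono_left nhdsWithin_le_nhds
  refine ge_of_tendsto hc ?_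
  filter_upwards [nhdsWithin_le_nhds h, self_mem_nhdsWithin] with t ht ht0
  have ht0 : 0 < t := ht0
  exact nonneg_of_mul_nonneg_right ht (by positivity)

end Perturb

/-! ### The balanced factorization -/

section SVD

variable {m n q : ℕ} {X : Matrix (Fin m) (Fin n) ℝ} {U : Matrix (Fin m) (Fin q) ℝ}
  {σ : Fin q → ℝ} {V : Matrix (Fin n) (Fin q) ℝ}

theorem IsSVD.isSingDecomp (h : IsSVD X U σ V) :
    IsSingDecomp X (fun i : {i // σ i ≠ 0} => colVec U i) (fun i => σ i)
      (fun i => colVec V i) := by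
  refine ⟨h.orthonormal_left, h.orthonormal_right, fun i => h.nonneg i, ?_⟩
  rw [← sum_eq_sum_subtype_ne_zero (s := σ) (h := fun i => σ i • outer (colVec U i) (colVec V i))
    fun i hi => by rw [hi, zero_smul], h.eq_mul]
  ext a c
  rw [Matrix.mul_apply, Matrix.sum_apply]
  exact Finset.sum_congr rfl fun i _ => by
    simp [outer, colVec, Matrix.vecMulVec_apply]; ring

/-- The left vectors are independent and lie in the range, since `X b_i = s_i a_i` with `s_i ≠ 0`.
-/
theorem IsSingDecomp.card_le_rank {ι : Type*} [Fintype ι] {a : ι → EuclideanSpace ℝ (Fin m)}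
    {s : ι → ℝ} {b : ι → EuclideanSpace ℝ (Fin n)} (h : IsSingDecomp X a s b)
    (hs : ∀ i, s i ≠ 0) : Fintype.card ι ≤ X.rank := by
  classical
  have hXb : ∀ i, Matrix.toEuclideanLin X (b i) = s i • a i := fun i => by
    rw [h.eq_sum, map_sum, LinearMap.sum_apply, Finset.sum_eq_single i]
    · simp [toEuclideanLin_outer, h.right.1 i]
    · intro j _ hj
      simp [toEuclideanLin_outer, orthonormal_iff_ite.1 h.right j i, hj]
    · simp
  have hmem : ∀ i, a i ∈ (Matrix.toEuclideanLin X).range := fun i =>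
    ⟨(s i)⁻¹ • b i, by rw [map_smul, hXb, smul_smul, inv_mul_cancel₀ (hs i), one_smul]⟩
  have hli : LinearIndependent ℝ fun i => (⟨a i, hmem i⟩ : (Matrix.toEuclideanLin X).range) :=
    LinearIndependent.of_comp (Submodule.subtype _) h.left.linearIndependent
  have h1 := hli.fintype_card_le_finrank
  rwa [Matrix.toEuclideanLin_eq_toLin_orthonormal, ← Matrix.rank_eq_finrank_range_toLin] at h1

theorem IsSVD.exists_eq_zero (h : IsSVD X U σ V) (hr : X.rank < q) : ∃ i, σ i = 0 := by
  by_contra! hne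
  have h1 := h.isSingDecomp.card_le_rank fun i => i.2
  rw [Fintype.card_congr (Equiv.subtypeUnivEquiv hne), Fintype.card_fin] at h1
  omega

theorem colVec_mul_diagonal (U : Matrix (Fin m) (Fin q) ℝ) (s : Fin q → ℝ) (i : Fin q) :
    colVec (U * Matrix.diagonal s) i = s i • colVec U i := by
  ext a; simp [colVec, mul_comm]

theorem IsSVD.sqrt_mul_sqrt (h : IsSVD X U σ V) :
    (U * Matrix.diagonal fun i => √(σ i)) * (V * Matrix.diagonal fun i => √(σ i)).transpose = X := by
  rw [Matrix.transpose_mul, Matrix.diagonal_transpose, Matrix.mul_assoc,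
    ← Matrix.mul_assoc (Matrix.diagonal _), Matrix.diagonal_mul_diagonal, ← Matrix.mul_assoc,
    h.eq_mul]
  simp only [Real.mul_self_sqrt (h.nonneg _)]

theorem IsSVD.half_norm_sq (h : IsSVD X U σ V) (i : Fin q) :
    (‖colVec (U * Matrix.diagonal fun i => √(σ i)) i‖ ^ 2 +
      ‖colVec (V * Matrix.diagonal fun i => √(σ i)) i‖ ^ 2) / 2 = σ i := by
  simp only [colVec_mul_diagonal, norm_smul, mul_pow, Real.norm_eq_abs, sq_abs,
    Real.sq_sqrt (h.nonneg i)]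
  by_cases hi : σ i = 0
  · simp [hi]
  · have h1 : ‖colVec U i‖ = 1 := h.orthonormal_left.1 ⟨i, hi⟩
    have h2 : ‖colVec V i‖ = 1 := h.orthonormal_right.1 ⟨i, hi⟩
    rw [h1, h2]; ring

/-- The two regularizers agree at a balanced factorization. -/
theorem IsSVD.Reg_eq_RegTilde (h : IsSVD X U σ V) {μ : ℝ} (hμ : 0 ≤ μ) :
    Reg (fmu μ) X = RegTilde (fmu μ) (U * Matrix.diagonal fun i => √(σ i))
      (V * Matrix.diagonal fun i => √(σ i)) := by
  simp only [RegTilde, h.half_norm_sq]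
  rw [sum_eq_sum_subtype_ne_zero (s := σ) fun i hi => by rw [hi, fmu_zero hμ], Reg_fmu_eq,
    h.isSingDecomp.Reg_eq isGauge_id, h.isSingDecomp.Reg_eq (isGauge_huber hμ), Finset.mul_sum,
    ← Finset.sum_sub_distrib]
  simp [huber]

end SVD

/-! ### Quadratic bound and subgradient inequality -/

section Decomp

variable {m n : ℕ} {ι : Type*} [Fintype ι] {X : Matrix (Fin m) (Fin n) ℝ}
  {a : ι → EuclideanSpace ℝ (Fin m)} {s : ι → ℝ} {b : ι → EuclideanSpace ℝ (Fin n)}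

/-- The quadratic upper bound of the smooth part of the regularizer. -/
theorem IsSingDecomp.Reg_huber_add_le (h : IsSingDecomp X a s b) {μ : ℝ} (hμ : 0 ≤ μ)
    (D : Matrix (Fin m) (Fin n) ℝ) (t : ℝ) :
    Reg (huber μ) (X + t • D) ≤ Reg (huber μ) X +
      t * ∑ i, 2 * min (s i) √μ * pairing (a i) D (b i) + t ^ 2 * ‖frobVec m n D‖ ^ 2 := by
  -- Subtracting `c` soft-thresholds the singular values: this proximal point of `X` attains the
  -- envelope at `t = 0`, and is kept fixed as `t` varies.
  set c : ι → ℝ := fun i => min (s i) √μ with hc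
  have hY : IsSingDecomp (∑ i, (s i - c i) • outer (a i) (b i)) a (fun i => s i - c i) b :=
    ⟨h.left, h.right, fun i => sub_nonneg.2 (min_le_left _ _), rfl⟩
  have h1 := Reg_le_of_decomp (isGauge_huber hμ) (by positivity) (huber_le hμ) hY (X + t • D)
  have h2 : X + t • D - ∑ i, (s i - c i) • outer (a i) (b i) =
      ∑ i, c i • outer (a i) (b i) + t • D := by
    conv_lhs => rw [h.eq_sum]
    simp only [sub_smul, Finset.sum_sub_distrib]
    abel
  have h3 : ‖frobVec m n (∑ i, c i • outer (a i) (b i))‖ ^ 2 = ∑ i, c i ^ 2 := by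
    rw [← real_inner_self_eq_norm_sq, map_sum]
    simp only [map_smul]
    rw [(orthonormal_frobVec_outer h.left h.right).inner_sum]
    simp [sq]
  have h4 : ⟪frobVec m n (∑ i, c i • outer (a i) (b i)), frobVec m n (t • D)⟫_ℝ =
      t * ∑ i, c i * pairing (a i) D (b i) := by
    rw [map_sum, map_smul, inner_smul_right, sum_inner]
    simp only [map_smul, inner_smul_left, inner_frobVec_outer, RCLike.conj_to_real]
  have h5 : ‖frobVec m n (t • D)‖ ^ 2 = t ^ 2 * ‖frobVec m n D‖ ^ 2 := by
    rw [map_smul, norm_smul, mul_pow, Real.norm_eq_abs, sq_abs]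
  rw [h2, map_add, norm_add_sq_real, h3, h4, h5] at h1
  rw [h.Reg_eq (isGauge_huber hμ)]
  simp only [huber_eq hμ, Finset.sum_add_distrib, ← Finset.mul_sum, mul_assoc] at h1 ⊢
  linarith

theorem Orthonormal.norm_sub_sum_sq {E : Type*} [NormedAddCommGroup E] [InnerProductSpace ℝ E]
    {v : ι → E} (hv : Orthonormal ℝ v) (x : E) :
    ‖x - ∑ i, ⟪v i, x⟫_ℝ • v i‖ ^ 2 = ‖x‖ ^ 2 - ∑ i, ⟪v i, x⟫_ℝ ^ 2 := by
  rw [norm_sub_sq_real, ← real_inner_self_eq_norm_sq (∑ i, ⟪v i, x⟫_ℝ • v i), hv.inner_sum,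
    inner_sum]
  simp only [inner_smul_right, real_inner_comm x, RCLike.conj_to_real, ← sq]
  ring

theorem Orthonormal.inner_sub_sum {E : Type*} [NormedAddCommGroup E] [InnerProductSpace ℝ E]
    {v : ι → E} (hv : Orthonormal ℝ v) (x : E) (j : ι) :
    ⟪v j, x - ∑ i, ⟪v i, x⟫_ℝ • v i⟫_ℝ = 0 := by
  rw [inner_sub_right, hv.inner_right_fintype, sub_self]

/-- A functional that is stationary on singular vectors and bounded on rank-one matrices is, up to
the gradient of the smooth part, a subgradient of the nuclear norm. -/
theorem subgradient_bound {μ : ℝ} (ℓ : Matrix (Fin m) (Fin n) ℝ →ₗ[ℝ] ℝ) (ha : Orthonormal ℝ a)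
    (hb : Orthonormal ℝ b)
    (hl : ∀ i v, ℓ (outer (a i) v) = -(fmuSlope μ (s i) * ⟪b i, v⟫_ℝ))
    (hr : ∀ i u, ℓ (outer u (b i)) = -(fmuSlope μ (s i) * ⟪a i, u⟫_ℝ))
    (hbd : ∀ u v, 0 ≤ √μ * (‖u‖ ^ 2 + ‖v‖ ^ 2) + ℓ (outer u v))
    (u : EuclideanSpace ℝ (Fin m)) (v : EuclideanSpace ℝ (Fin n)) :
    ∑ i, 2 * min (s i) √μ * pairing (a i) (outer u v) (b i) - ℓ (outer u v) ≤
      √μ * (‖u‖ ^ 2 + ‖v‖ ^ 2) := by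
  -- Off the singular spans only `hbd` is known; `hl` and `hr` handle the span components, and the
  -- mixed terms vanish by orthogonality.
  set u' := u - ∑ i, ⟪a i, u⟫_ℝ • a i with hu'
  set v' := v - ∑ i, ⟪b i, v⟫_ℝ • b i with hv'
  have hnu := ha.norm_sub_sum_sq u
  have hnv := hb.norm_sub_sum_sq v
  rw [← hu'] at hnu
  rw [← hv'] at hnv
  have h1 : ℓ (outer u v) = ℓ (outer u' v) +
      ∑ i, ⟪a i, u⟫_ℝ * -(fmuSlope μ (s i) * ⟪b i, v⟫_ℝ) := by
    have : u = u' + ∑ i, ⟪a i, u⟫_ℝ • a i := by rw [hu']; abel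
    conv_lhs => rw [this]
    simp [outer_add_left, outer_sum_left, outer_smul_left, hl]
  have h2 : ℓ (outer u' v) = ℓ (outer u' v') := by
    have : v = v' + ∑ i, ⟪b i, v⟫_ℝ • b i := by rw [hv']; abel
    conv_lhs => rw [this]
    simp [outer_add_right, outer_sum_right, outer_smul_right, hr, hu', ha.inner_sub_sum]
  have h3 := hbd u' v'
  rw [h1, h2, sub_add_eq_sub_sub, sub_right_comm, ← Finset.sum_sub_distrib]
  have h4 : ∑ i, (2 * min (s i) √μ * pairing (a i) (outer u v) (b i) -
      ⟪a i, u⟫_ℝ * -(fmuSlope μ (s i) * ⟪b i, v⟫_ℝ)) ≤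
      √μ * (∑ i, ⟪a i, u⟫_ℝ ^ 2 + ∑ i, ⟪b i, v⟫_ℝ ^ 2) := by
    rw [← Finset.sum_add_distrib, Finset.mul_sum]
    refine Finset.sum_le_sum fun i _ => ?_
    rw [pairing_outer, real_inner_comm (b i) v]
    have h5 := fmuSlope_add_min μ (s i)
    have h6 : 2 * min (s i) √μ * (⟪a i, u⟫_ℝ * ⟪b i, v⟫_ℝ) -
        ⟪a i, u⟫_ℝ * -(fmuSlope μ (s i) * ⟪b i, v⟫_ℝ) = 2 * √μ * (⟪a i, u⟫_ℝ * ⟪b i, v⟫_ℝ) := by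
      rw [← h5]; ring
    rw [h6]
    nlinarith [mul_nonneg (Real.sqrt_nonneg μ) (sq_nonneg (⟪a i, u⟫_ℝ - ⟪b i, v⟫_ℝ))]
  -- By Pythagoras the bounds on and off the spans add up to the full norms.
  rw [hnu, hnv] at h3
  nlinarith

/-- The objective decreases at most quadratically along every line through a stationary point. -/
theorem IsSingDecomp.matObj_sub_ge (h : IsSingDecomp X a s b) {μ : ℝ} (hμ : 0 ≤ μ) {p : ℕ}
    {A : Matrix (Fin m) (Fin n) ℝ →ₗ[ℝ] EuclideanSpace ℝ (Fin p)} {y : EuclideanSpace ℝ (Fin p)}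
    (hl : ∀ i v, fitDeriv A y X (outer (a i) v) = -(fmuSlope μ (s i) * ⟪b i, v⟫_ℝ))
    (hr : ∀ i u, fitDeriv A y X (outer u (b i)) = -(fmuSlope μ (s i) * ⟪a i, u⟫_ℝ))
    (hbd : ∀ u v, 0 ≤ √μ * (‖u‖ ^ 2 + ‖v‖ ^ 2) + fitDeriv A y X (outer u v))
    (D : Matrix (Fin m) (Fin n) ℝ) (t : ℝ) :
    -(t ^ 2 * ‖frobVec m n D‖ ^ 2) ≤
      matObj (fmu μ) A y (X + t • D) - matObj (fmu μ) A y X := by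
  set ψ : Matrix (Fin m) (Fin n) ℝ →ₗ[ℝ] ℝ :=
    ∑ i, (2 * min (s i) √μ) • (innerₗ _ (frobVec m n (outer (a i) (b i)))).comp (frobVec m n) -
      fitDeriv A y X with hψ
  have hψa : ∀ Z, ψ Z = ∑ i, 2 * min (s i) √μ * pairing (a i) Z (b i) - fitDeriv A y X Z := by
    intro Z
    simp [hψ, inner_frobVec_outer]
  have h1 := le_mul_Reg_id ψ (c := √μ) (fun u v => by
    rw [hψa]
    exact subgradient_bound _ h.left h.right hl hr hbd u v) (X + t • D)
  -- Equality at `X` turns the bound `h1` at `X + t • D` into the subgradient inequality.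
  have h2 : ψ X = 2 * √μ * Reg (fun x => x) X := by
    have : fitDeriv A y X X = ∑ i, s i * -(fmuSlope μ (s i)) := by
      generalize fitDeriv A y X = ℓ at *
      rw [h.eq_sum, map_sum]
      refine Finset.sum_congr rfl fun i _ => ?_
      rw [map_smul, hl, real_inner_self_eq_norm_sq, h.right.1 i]
      simp
    rw [hψa, this, ← Finset.sum_sub_distrib, h.Reg_eq isGauge_id, Finset.mul_sum]
    refine Finset.sum_congr rfl fun i _ => ?_
    rw [h.pairing_self, ← fmuSlope_add_min μ (s i)]
    ring
  have h3 := h.Reg_huber_add_le hμ D t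
  have h4 := norm_fit_add_sq A y X (t • D)
  have h5 := sq_nonneg ‖A (t • D)‖
  rw [map_add, map_smul, h2, hψa, smul_eq_mul, mul_sub] at h1
  rw [map_smul, smul_eq_mul] at h4
  simp only [matObj, Reg_fmu_eq]
  linarith

end Decomp

/-! ### Main theorem -/

theorem theorem2 {m n p k : ℕ} (μ : ℝ) (hμ : 0 ≤ μ)
    (A : Matrix (Fin m) (Fin n) ℝ →ₗ[ℝ] EuclideanSpace ℝ (Fin p))
    (b : EuclideanSpace ℝ (Fin p))
    (X : Matrix (Fin m) (Fin n) ℝ)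
    (U : Matrix (Fin m) (Fin (2 * k)) ℝ) (σ : Fin (2 * k) → ℝ)
    (V : Matrix (Fin n) (Fin (2 * k)) ℝ) (hX : IsSVD X U σ V)
    (B : Matrix (Fin m) (Fin (2 * k)) ℝ) (C : Matrix (Fin n) (Fin (2 * k)) ℝ)
    (hB : B = U * Matrix.diagonal (fun i => √(σ i)))
    (hC : C = V * Matrix.diagonal (fun i => √(σ i)))
    (hmin : IsLocalMin
      (fun P : Matrix (Fin m) (Fin (2 * k)) ℝ × Matrix (Fin n) (Fin (2 * k)) ℝ =>
        bilinObj (fmu μ) A b P.1 P.2) (B, C))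
    (hrank : X.rank < k) :
    Reg (fmu μ) X = RegTilde (fmu μ) B C ∧
      ∀ X' : Matrix (Fin m) (Fin n) ℝ, X'.rank ≤ k →
        ∃ L : ℝ, HasDirDeriv (matObj (fmu μ) A b) X (X' - X) L ∧ 0 ≤ L := by
  subst hB hC
  refine ⟨hX.Reg_eq_RegTilde hμ, fun X' _ => ?_⟩
  obtain ⟨L, hL⟩ := exists_hasDirDeriv_matObj A b X hμ (X' - X)
  refine ⟨L, hL, hL.nonneg fun t _ => hX.isSingDecomp.matObj_sub_ge hμ ?_ ?_ ?_ (X' - X) t⟩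
  · rintro ⟨i, hi⟩ v
    -- Moving only the column of `C` isolates `ℓ(a_i vᵀ)`, up to the factor `√(σ i) ≠ 0`.
    have h := column_stationary hmin i 0 v (congrArg _ (hX.half_norm_sq i))
    have h0 : √(σ i) ≠ 0 := (Real.sqrt_pos.2 ((hX.nonneg i).lt_of_ne' hi)).ne'
    simp only [hX.sqrt_mul_sqrt, colVec_mul_diagonal, outer_zero_left, inner_zero_right, zero_add,
      outer_smul_left, map_smul, inner_smul_left, RCLike.conj_to_real, smul_eq_mul] at h
    refine mul_left_cancel₀ h0 ?_
    linarith
  · rintro ⟨i, hi⟩ u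
    have h := column_stationary hmin i u 0 (congrArg _ (hX.half_norm_sq i))
    have h0 : √(σ i) ≠ 0 := (Real.sqrt_pos.2 ((hX.nonneg i).lt_of_ne' hi)).ne'
    simp only [hX.sqrt_mul_sqrt, colVec_mul_diagonal, outer_zero_right, inner_zero_right, add_zero,
      outer_smul_right, map_smul, inner_smul_left, RCLike.conj_to_real, smul_eq_mul] at h
    refine mul_left_cancel₀ h0 ?_
    linarith
  · obtain ⟨i, hi⟩ := hX.exists_eq_zero (by omega)
    intro u v
    have h := zero_column_second_order hmin (i := i) (by simp [colVec_mul_diagonal, hi])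
      (by simp [colVec_mul_diagonal, hi]) u v
    rwa [hX.sqrt_mul_sqrt] at h
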